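/- Fix $d$ and equip $\mathbb{R}^d$ with the norm $\|x\|=\max_i|x_i|$; let $B_r(x)$ be the closed ball of radius $r$ about $x$, so $B_1(0)=[-1,1]^d$. Let $\mathcal{M}$ be the space of Radon measures on $\mathbb{R}^d$ with its Borel structure, and $\mathcal{M}^*=\{\mu\in\mathcal{M}:\mu(B_1(0))=1\}$. For $\mu\in\mathcal{M}$ with $0<\mu(B_1(0))<\infty$ put $\mu^*=\mu/\mu(B_1(0))$. For $t\in\mathbb{R}$ let $S_t^*\mu=(S_t\mu)^*$, where $S_t\mu$ is the push-forward of $\mu$ under $y\mapsto e^ty$, and for $x\in\mathbb{R}^d$ let $T_x^*\mu=(T_x\mu)^*$, where $T_x\mu$ is the push-forward of $\mu$ under $y\mapsto y-x$. A fractal distribution is a Borel probability measure $P$ on $\mathcal{M}^*$ which is invariant under $S_t^*$ for all $t\in\mathbb{R}$ and is quasi-Palm: for every bounded open neighborhood $U$ of the origin, the measures $P$ and $\int\left(\int_U\delta_{T_x^*\mu}\,d\mu(x)\right)dP(\mu)$ have the same null sets. It is ergodic if $P(A)\in\{0,1\}$ for every measurable $A$ with $P\big((S_t^*)^{-1}A\,\triangle\,A\big)=0$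 for all $t\in\mathbb{R}$. A measure $\mu\in\mathcal{M}$ is exact dimensional with dimension $\dim\mu=\alpha$ if for $\mu$-a.e. $x$ $$\liminf_{r\to0}\frac{\log\mu(B_r(x))}{\log r}=\limsup_{r\to0}\frac{\log\mu(B_r(x))}{\log r}=\alpha .$$ Let $P$ be an ergodic fractal distribution. Then there is a real number $\dim P$ such that $P$-a.e. $\mu$ is exact dimensional with $\dim\mu=\dim P$. Moreover, for every $0<r<1$ the function $\mu\mapsto\log\mu(B_r(0))/\log r$ is $P$-integrable and $$\dim P=\int\frac{\log\mu(B_r(0))}{\log r}\,dP(\mu).$$ -/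

import Mathlib

open MeasureTheory Metric Set Filter
open scoped Topology ENNReal

noncomputable section

namespace FractalDistribution

/-- The space `ℝ^d`. As a space of functions it carries the sup norm, so `closedBall x r` is the
closed cube of side `2r` centred at `x`, and `closedBall 0 1 = [-1,1]^d`. -/
abbrev Space (d : ℕ) : Type := Fin d → ℝ

/-- The Radon measures on `ℝ^d`: the Borel measures that are finite on compact sets. As everywhere
in Mathlib, measurable sets of measures are those of the smallest σ-algebra for which all the
evaluations `μ ↦ μ A`, `A` Borel, are measurable; on Radon measures on `ℝ^d` it is the Borel
σ-algebra of the weak-* topology. -/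
def radonMeasures (d : ℕ) : Set (Measure (Space d)) :=
  {μ | IsLocallyFiniteMeasure μ}

/-- The Radon measures normalized by `μ [-1,1]^d = 1`. -/
def normalizedMeasures (d : ℕ) : Set (Measure (Space d)) :=
  {μ | μ ∈ radonMeasures d ∧ μ (closedBall 0 1) = 1}

variable {d : ℕ}

/-- `μ^* = μ / μ [-1,1]^d`, meaningful when `0 < μ [-1,1]^d < ∞`. If `μ [-1,1]^d = 0`, the value is
a measure that is not normalized. -/
def normalize (μ : Measure (Space d)) : Measure (Space d) :=
  (μ (closedBall 0 1))⁻¹ • μ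

/-- `S_t^* μ`: the image of `μ` under `y ↦ e^t y`, normalized. -/
def scaleStar (t : ℝ) (μ : Measure (Space d)) : Measure (Space d) :=
  normalize (μ.map fun y => Real.exp t • y)

/-- `T_x^* μ`: the image of `μ` under `y ↦ y - x`, normalized. -/
def translateStar (x : Space d) (μ : Measure (Space d)) : Measure (Space d) :=
  normalize (μ.map fun y => y - x)

/-- The `U`-diffusion `⟨μ⟩_U = ∫_U δ_{T_x^* μ} dμ(x)`: the image of the restriction of `μ` to `U`
under `x ↦ T_x^* μ`. -/
def diffusion (U : Set (Space d)) (μ : Measure (Space d)) : Measure (Measure (Space d)) :=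
  (μ.restrict U).map fun x => translateStar x μ

/-- `P` is quasi-Palm: `P` and `∫ ⟨μ⟩_U dP(μ)` have the same null sets for every bounded open
neighbourhood `U` of the origin. -/
def IsQuasiPalm (P : Measure (Measure (Space d))) : Prop :=
  ∀ U : Set (Space d), IsOpen U → Bornology.IsBounded U → (0 : Space d) ∈ U →
    P ≪ P.bind (diffusion U) ∧ P.bind (diffusion U) ≪ P

/-- A fractal distribution: a probability distribution on the normalized Radon measures which is
invariant under the scaling flow `S^*` and quasi-Palm. -/
structure IsFractalDistribution (P : Measure (Measure (Space d))) : Prop where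
  isProbabilityMeasure : IsProbabilityMeasure P
  ae_mem : ∀ᵐ μ ∂P, μ ∈ normalizedMeasures d
  invariant : ∀ t : ℝ, MeasurePreserving (scaleStar t) P P
  quasiPalm : IsQuasiPalm P

/-- An ergodic fractal distribution: one for which every (mod `P`) `S^*`-invariant measurable set
has probability `0` or `1`. -/
structure IsErgodicFractalDistribution (P : Measure (Measure (Space d))) : Prop
    extends IsFractalDistribution P where
  ergodic : ∀ A : Set (Measure (Space d)), MeasurableSet A →
    (∀ t : ℝ, P (symmDiff (scaleStar t ⁻¹' A) A) = 0) → P A = 0 ∨ P A = 1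

/-- The quotient `log μ(B_r(x)) / log r`, in the extended reals, with `log 0 = -∞`. -/
def logQuotient (μ : Measure (Space d)) (x : Space d) (r : ℝ) : EReal :=
  ENNReal.log (μ (closedBall x r)) / (Real.log r : EReal)

/-- The upper local dimension of `μ` at `x`. -/
def upperLocalDim (μ : Measure (Space d)) (x : Space d) : EReal :=
  limsup (logQuotient μ x) (𝓝[>] (0 : ℝ))

/-- The lower local dimension of `μ` at `x`. -/
def lowerLocalDim (μ : Measure (Space d)) (x : Space d) : EReal :=
  liminf (logQuotient μ x) (𝓝[>] (0 : ℝ))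

/-- `μ` is exact dimensional with exact dimension `α`: at `μ`-a.e. point the upper and lower local
dimensions agree, and their common value is `α`. -/
def HasExactDim (μ : Measure (Space d)) (α : EReal) : Prop :=
  ∀ᵐ x ∂μ, lowerLocalDim μ x = α ∧ upperLocalDim μ x = α

/-! Measurability of the maps above, so that the push-forwards and integrals in the definitions are
the genuine ones. -/

lemma measurable_normalize : Measurable (normalize (d := d)) := by
  refine Measure.measurable_of_measurable_coe _ fun s hs => ?_
  simp only [normalize, Measure.smul_apply, smul_eq_mul]
  exact (Measure.measurable_coe measurableSet_closedBall).inv.mul (Measure.measurable_coe hs)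

lemma measurable_scaleStar (t : ℝ) : Measurable (scaleStar (d := d) t) :=
  measurable_normalize.comp (Measure.measurable_map _ (by fun_prop))

lemma mem_radonMeasures_iff (μ : Measure (Space d)) :
    μ ∈ radonMeasures d ↔ ∀ n : ℕ, μ (closedBall 0 n) < ∞ := by
  constructor
  · intro h n
    have : IsLocallyFiniteMeasure μ := h
    exact (isCompact_closedBall _ _).measure_lt_top
  · intro h
    refine ⟨fun x => ?_⟩
    obtain ⟨n, hn⟩ := exists_nat_gt (dist x 0)
    exact ⟨closedBall 0 n, mem_of_superset (isOpen_ball.mem_nhds (by simpa using hn)) ball_subset_closedBall, h n⟩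

lemma measurableSet_radonMeasures : MeasurableSet (radonMeasures d) := by
  have : radonMeasures d = ⋂ n : ℕ, {μ | μ (closedBall 0 n) < ∞} := by
    ext μ; simp [mem_radonMeasures_iff]
  rw [this]
  exact MeasurableSet.iInter fun n =>
    measurableSet_lt (Measure.measurable_coe measurableSet_closedBall) measurable_const

/-- The tautological kernel `μ ↦ μ` on Radon measures. -/
def idKernel (d : ℕ) : ProbabilityTheory.Kernel (radonMeasures d) (Space d) := ⟨Subtype.val, measurable_subtype_coe⟩

instance isSFiniteKernel_idKernel : ProbabilityTheory.IsSFiniteKernel (idKernel d) := by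
  let A : ℕ → Set (Space d) := disjointed fun n => closedBall 0 (n : ℝ)
  have hA : ∀ n, MeasurableSet (A n) := MeasurableSet.disjointed fun n => measurableSet_closedBall
  have hAU : ⋃ n, A n = univ := by
    rw [iUnion_disjointed]; exact iUnion_closedBall_nat 0
  have hAd : Pairwise (Function.onFun Disjoint A) := disjoint_disjointed _
  have hfin : ∀ (μ : radonMeasures d) n, (μ : Measure (Space d)) (A n) < ∞ := fun μ n =>
    (measure_mono (disjointed_subset _ n)).trans_lt ((mem_radonMeasures_iff _).1 μ.2 n)
  have key : idKernel d = ProbabilityTheory.Kernel.sum fun n => (idKernel d).restrict (hA n) := by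
    ext μ s hs
    rw [ProbabilityTheory.Kernel.sum_apply' _ _ hs]
    simp_rw [ProbabilityTheory.Kernel.restrict_apply]
    rw [← Measure.sum_apply _ hs, ← Measure.restrict_iUnion hAd hA, hAU, Measure.restrict_univ]
  rw [key]
  refine ProbabilityTheory.Kernel.isSFiniteKernel_sum (hκs := fun n => ?_)
  let B : ℕ → Set (radonMeasures d) := fun k => {μ | ⌊((μ : Measure (Space d)) (A n)).toNNReal⌋₊ = k}
  have hm : Measurable fun μ : radonMeasures d => (μ : Measure (Space d)) (A n) :=
    (Measure.measurable_coe (hA n)).comp measurable_subtype_coe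
  have hB : ∀ k, MeasurableSet (B k) := fun k =>
    (Nat.measurable_floor.comp hm.ennreal_toNNReal) (measurableSet_singleton k)
  classical
  have key2 : (idKernel d).restrict (hA n)
      = ProbabilityTheory.Kernel.sum fun k => ProbabilityTheory.Kernel.piecewise (hB k) ((idKernel d).restrict (hA n)) 0 := by
    ext μ s hs
    rw [ProbabilityTheory.Kernel.sum_apply' _ _ hs]
    simp only [ProbabilityTheory.Kernel.piecewise_apply']
    rw [tsum_eq_single ⌊((μ : Measure (Space d)) (A n)).toNNReal⌋₊]
    · simp [B]
    · intro k hk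
      have : μ ∉ B k := fun h => hk h.symm
      simp [this]
  rw [key2]
  refine ProbabilityTheory.Kernel.isSFiniteKernel_sum (hκs := fun k => ?_)
  have : ProbabilityTheory.IsFiniteKernel (ProbabilityTheory.Kernel.piecewise (hB k) ((idKernel d).restrict (hA n)) 0) := by
    refine ⟨(k + 1 : ℝ≥0∞), by finiteness, fun μ => ?_⟩
    rw [ProbabilityTheory.Kernel.piecewise_apply']
    split_ifs with h
    · rw [ProbabilityTheory.Kernel.restrict_apply, Measure.restrict_apply_univ]
      have h2 : ⌊((μ : Measure (Space d)) (A n)).toNNReal⌋₊ = k := h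
      have := (Nat.lt_floor_add_one ((μ : Measure (Space d)) (A n)).toNNReal).le
      rw [h2] at this
      change (μ : Measure (Space d)) (A n) ≤ _
      rw [← ENNReal.coe_toNNReal (hfin μ n).ne]
      exact_mod_cast this
    · simp
  infer_instance

lemma measurable_translate : Measurable fun p : radonMeasures d × Space d => translateStar p.2 p.1 := by
  refine measurable_normalize.comp ?_
  refine Measure.measurable_of_measurable_coe _ fun s hs => ?_
  have : ∀ p : radonMeasures d × Space d, ((p.1 : Measure (Space d)).map fun y => y - p.2) s =
      (ProbabilityTheory.Kernel.prodMkRight (Space d) (idKernel d)) p (Prod.mk p ⁻¹' {q | q.2 - q.1.2 ∈ s}) := by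
    intro p
    rw [Measure.map_apply (by fun_prop) hs]; rfl
  simp_rw [this]
  refine ProbabilityTheory.Kernel.measurable_kernel_prodMk_left ?_
  exact (measurable_snd.sub measurable_fst.snd) hs

lemma measurable_translateStar_left {μ : Measure (Space d)} (h : μ ∈ radonMeasures d) :
    Measurable fun x => translateStar x μ := by
  have h0 : Measurable fun x : Space d => ((⟨μ, h⟩, x) : radonMeasures d × Space d) :=
    measurable_prodMk_left
  simpa only [Function.comp_def] using (measurable_translate (d := d)).comp h0

lemma measurable_diffusion {U : Set (Space d)} (hU : MeasurableSet U) :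
    Measurable fun μ : radonMeasures d => diffusion U (μ : Measure (Space d)) := by
  refine Measure.measurable_of_measurable_coe _ fun s hs => ?_
  have hV : MeasurableSet {q : radonMeasures d × Space d | translateStar q.2 q.1 ∈ s ∧ q.2 ∈ U} :=
    (measurable_translate hs).inter (measurable_snd hU)
  have h2 := ProbabilityTheory.Kernel.measurable_kernel_prodMk_left (κ := idKernel d) hV
  convert h2 using 1
  funext μ
  have h1 := measurable_translateStar_left μ.2
  rw [diffusion, Measure.map_apply h1 hs, Measure.restrict_apply (h1 hs)]
  rfl

/-- The integrand of `∫ ⟨μ⟩_U dP(μ)` is measurable, so `P.bind (diffusion U)` is that integral. -/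
lemma aemeasurable_diffusion {P : Measure (Measure (Space d))} (hP : ∀ᵐ μ ∂P, μ ∈ radonMeasures d)
    {U : Set (Space d)} (hU : MeasurableSet U) : AEMeasurable (diffusion U) P := by
  rw [← Measure.restrict_eq_self_of_ae_mem hP,
    aemeasurable_restrict_iff_comap_subtype measurableSet_radonMeasures]
  exact (measurable_diffusion hU).aemeasurable

end FractalDistribution

end

/-! Put `negLogMass t μ` $= -\log\mu(B_{e^{-t}}(0))$. Rescaling by $e^s$ divides by the mass of
$B_{e^{-s}}(0)$, so this is an additive cocycle over the scaling flow (`negLogMass_scaleStar`), and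
its values at times $nh$ are Birkhoff sums of `negLogMass h` (`birkhoffSum_negLogMass`). An ergodic
theorem then gives a constant growth rate $\frac1h\int$ `negLogMass h` $dP$, which is the local
dimension at the origin. Quasi-Palmness moves this from the origin to $\mu$-almost every point
(`ae_hasExactDim`).

Integrability is not given. By quasi-Palmness the origin is as good as a $\mu$-typical point, where
differentiation of measures gives $\mu(B_r)\ge c\,r^d$; hence some Birkhoff average is at most
$(d+1)h$, and the maximal ergodic theorem applied to truncations bounds the integral.

The ergodic theorem also comes from the maximal one. The event that the growth rate is at most $c$
is invariant under the whole flow, so it has probability 0 or 1; probability 0 would force the mean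
to be at least $ch$. Only the flow is assumed ergodic, not its time-$h$ map, so the event has to be
invariant under all real times; monotonicity of the cocycle in $t$ ensures this. -/

/-! ### Maximal ergodic theorem -/

section MaximalErgodic

variable {X : Type*} {T : X → X} {g : X → ℝ}

/-- The maximum of the Birkhoff sums `birkhoffSum T g n` over `n ≤ N`. -/
noncomputable def maxBirkhoffSum (T : X → X) (g : X → ℝ) : ℕ → X → ℝ
  | 0, _ => 0
  | N + 1, x => max 0 (g x + maxBirkhoffSum T g N (T x))

lemma maxBirkhoffSum_nonneg (N : ℕ) (x : X) : 0 ≤ maxBirkhoffSum T g N x := by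
  cases N <;> simp [maxBirkhoffSum]

lemma maxBirkhoffSum_le_succ (N : ℕ) (x : X) :
    maxBirkhoffSum T g N x ≤ maxBirkhoffSum T g (N + 1) x := by
  induction N generalizing x with
  | zero => simp [maxBirkhoffSum]
  | succ N ih =>
    rw [maxBirkhoffSum, maxBirkhoffSum]
    gcongr
    exact ih _

lemma birkhoffSum_le_maxBirkhoffSum (n : ℕ) (x : X) :
    birkhoffSum T g n x ≤ maxBirkhoffSum T g n x := by
  induction n generalizing x with
  | zero => simp [maxBirkhoffSum]
  | succ n ih =>
    rw [birkhoffSum_succ', maxBirkhoffSum]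
    exact le_max_of_le_right (by gcongr; exact ih _)

variable [MeasurableSpace X] {μ : Measure X}

lemma MeasureTheory.Integrable.maxBirkhoffSum (hT : MeasurePreserving T μ μ)
    (hg : Integrable g μ) (N : ℕ) : Integrable (maxBirkhoffSum T g N) μ := by
  induction N with
  | zero => exact integrable_zero _ _ _
  | succ N ih =>
    have h := (integrable_zero X ℝ μ).sup (hg.add (hT.integrable_comp_of_integrable ih))
    exact h

/-- Garsia's argument. Write $M_N$ for `maxBirkhoffSum T g N`. On the set, $g = M_{N+1} - M_N\circ
T$; off it, $M_{N+1} = 0 \le M_N\circ T$. So $g$ times the indicator dominates $M_{N+1} - M_N\circ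
T$, whose integral is nonnegative since $M_{N+1}\ge M_N$ and $T$ preserves $\mu$. -/
lemma setIntegral_nonneg_of_maxBirkhoffSum (hT : MeasurePreserving T μ μ)
    (hg : Integrable g μ) (N : ℕ)
    (hE : MeasurableSet {x | 0 ≤ g x + maxBirkhoffSum T g N (T x)}) :
    0 ≤ ∫ x in {x | 0 ≤ g x + maxBirkhoffSum T g N (T x)}, g x ∂μ := by
  have hN := hg.maxBirkhoffSum hT N
  have hN' := hg.maxBirkhoffSum hT (N + 1)
  have hNT := hT.integrable_comp_of_integrable hN
  have hmono : ∫ x, maxBirkhoffSum T g N x ∂μ ≤ ∫ x, maxBirkhoffSum T g (N + 1) x ∂μ :=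
    integral_mono hN hN' (maxBirkhoffSum_le_succ N)
  have hinv : ∫ x, maxBirkhoffSum T g N (T x) ∂μ = ∫ x, maxBirkhoffSum T g N x ∂μ := by
    conv_rhs => rw [← hT.map_eq]
    rw [integral_map hT.aemeasurable]
    rw [hT.map_eq]; exact hN.aestronglyMeasurable
  rw [← integral_indicator hE]
  calc (0 : ℝ) ≤ ∫ x, maxBirkhoffSum T g (N + 1) x ∂μ - ∫ x, maxBirkhoffSum T g N (T x) ∂μ := by
        rw [hinv]; linarith
    _ = ∫ x, (maxBirkhoffSum T g (N + 1) x - maxBirkhoffSum T g N (T x)) ∂μ :=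
        (integral_sub hN' hNT).symm
    _ ≤ _ := by
        refine integral_mono (hN'.sub hNT) (hg.indicator hE) fun x => ?_
        by_cases hx : 0 ≤ g x + maxBirkhoffSum T g N (T x)
        · rw [indicator_of_mem (by exact hx)]
          simp [maxBirkhoffSum, max_eq_right hx]
        · rw [indicator_of_notMem (by exact hx)]
          have := maxBirkhoffSum_nonneg (T := T) (g := g) N (T x)
          simp only [maxBirkhoffSum, max_eq_left (not_le.1 hx).le]
          linarith

lemma Measurable.maxBirkhoffSum (hT : Measurable T) (hg : Measurable g) (N : ℕ) :
    Measurable (maxBirkhoffSum T g N) := by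
  induction N with
  | zero => exact measurable_const
  | succ N ih => exact measurable_const.max (hg.add (ih.comp hT))

/-- The maximal ergodic theorem, when almost every orbit has a nonnegative Birkhoff sum. -/
theorem integral_nonneg_of_ae_exists_birkhoffSum_nonneg (hT : MeasurePreserving T μ μ)
    (hgm : Measurable g) (hg : Integrable g μ)
    (h : ∀ᵐ x ∂μ, ∃ n : ℕ, 0 < n ∧ 0 ≤ birkhoffSum T g n x) : 0 ≤ ∫ x, g x ∂μ := by
  let E : ℕ → Set X := fun N => {x | 0 ≤ g x + maxBirkhoffSum T g N (T x)}
  have hE : ∀ N, MeasurableSet (E N) := fun N => measurableSet_le measurable_const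
    (hgm.add ((hT.measurable.maxBirkhoffSum hgm N).comp hT.measurable))
  have hmono : Monotone E := monotone_nat_of_le_succ fun N x hx =>
    le_trans (b := g x + maxBirkhoffSum T g N (T x)) hx
      (add_le_add_right (maxBirkhoffSum_le_succ N (T x)) (g x))
  have hlim := tendsto_setIntegral_of_monotone (μ := μ) (f := g) hE hmono hg.integrableOn
  have huniv : ∫ x in ⋃ N, E N, g x ∂μ = ∫ x, g x ∂μ := by
    refine setIntegral_eq_integral_of_ae_compl_eq_zero ?_
    filter_upwards [h] with x ⟨n, hn, hx⟩ hxE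
    refine absurd (mem_iUnion.2 ⟨n - 1, ?_⟩) hxE
    obtain ⟨m, rfl⟩ : ∃ m, n = m + 1 := ⟨n - 1, by omega⟩
    rw [birkhoffSum_succ'] at hx
    exact hx.trans (by gcongr; exact birkhoffSum_le_maxBirkhoffSum m _)
  rw [huniv] at hlim
  exact ge_of_tendsto' hlim fun N => setIntegral_nonneg_of_maxBirkhoffSum hT hg N (hE N)

variable [IsProbabilityMeasure μ] {f : X → ℝ} {c : ℝ}

theorem le_integral_of_ae_exists_le_birkhoffSum (hT : MeasurePreserving T μ μ)
    (hfm : Measurable f) (hf : Integrable f μ)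
    (h : ∀ᵐ x ∂μ, ∃ n : ℕ, 0 < n ∧ n * c ≤ birkhoffSum T f n x) : c ≤ ∫ x, f x ∂μ := by
  have := integral_nonneg_of_ae_exists_birkhoffSum_nonneg hT (hfm.sub_const c)
    (hf.sub (integrable_const c)) (h.mono fun x ⟨n, hn, hx⟩ => ⟨n, hn, by
      simpa [birkhoffSum, Finset.sum_sub_distrib] using hx⟩)
  rw [integral_sub hf (integrable_const c)] at this
  simpa using this

theorem integral_le_of_ae_exists_birkhoffSum_le (hT : MeasurePreserving T μ μ)
    (hfm : Measurable f) (hf : Integrable f μ)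
    (h : ∀ᵐ x ∂μ, ∃ n : ℕ, 0 < n ∧ birkhoffSum T f n x ≤ n * c) : ∫ x, f x ∂μ ≤ c := by
  have := le_integral_of_ae_exists_le_birkhoffSum (c := -c) hT hfm.neg hf.neg
    (h.mono fun x ⟨n, hn, hx⟩ => ⟨n, hn, by
      simpa [birkhoffSum, Finset.sum_neg_distrib] using hx⟩)
  simp only [Pi.neg_apply, integral_neg] at this
  linarith

/-- The truncations $\min(f,K)$ are bounded and inherit the bound on Birkhoff sums, so their
integrals are at most $c$; Fatou's lemma then lets $K\to\infty$. -/
theorem integrable_of_ae_exists_birkhoffSum_le (hT : MeasurePreserving T μ μ)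
    (hfm : Measurable f) (hf : 0 ≤ᵐ[μ] f)
    (h : ∀ᵐ x ∂μ, ∃ n : ℕ, 0 < n ∧ birkhoffSum T f n x ≤ n * c) : Integrable f μ := by
  have hm : ∀ K : ℕ, Measurable fun x => min (f x) K := fun K => hfm.min measurable_const
  have hnn : ∀ K : ℕ, 0 ≤ᵐ[μ] fun x => min (f x) K := fun K =>
    hf.mono fun x hx => le_min hx K.cast_nonneg
  have hi : ∀ K : ℕ, Integrable (fun x => min (f x) K) μ := fun K =>
    Integrable.of_bound (hm K).aestronglyMeasurable K <| (hnn K).mono fun x hx => by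
      rw [Real.norm_of_nonneg hx]; exact min_le_right _ _
  have hle : ∀ K : ℕ, ∫ x, min (f x) K ∂μ ≤ c := fun K =>
    integral_le_of_ae_exists_birkhoffSum_le hT (hm K) (hi K) <| h.mono fun x ⟨n, hn, hx⟩ =>
      ⟨n, hn, le_trans (Finset.sum_le_sum fun k _ => min_le_left _ _) hx⟩
  have hlim : ∀ x, Tendsto (fun K : ℕ => ENNReal.ofReal (min (f x) K)) atTop
      (𝓝 (ENNReal.ofReal (f x))) := fun x => by
    refine tendsto_const_nhds.congr' ?_
    filter_upwards [tendsto_natCast_atTop_atTop.eventually_ge_atTop (f x)] with K hK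
    rw [min_eq_left hK]
  refine ⟨hfm.aestronglyMeasurable, (hasFiniteIntegral_iff_ofReal hf).2 ?_⟩
  calc ∫⁻ x, ENNReal.ofReal (f x) ∂μ
      = ∫⁻ x, liminf (fun K : ℕ => ENNReal.ofReal (min (f x) K)) atTop ∂μ :=
        lintegral_congr fun x => (hlim x).liminf_eq.symm
    _ ≤ liminf (fun K : ℕ => ∫⁻ x, ENNReal.ofReal (min (f x) K) ∂μ) atTop :=
        lintegral_liminf_le fun K => (hm K).ennreal_ofReal
    _ ≤ liminf (fun _ : ℕ => ENNReal.ofReal c) atTop := by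
        refine liminf_le_liminf (Eventually.of_forall fun K => ?_)
        rw [← ofReal_integral_eq_lintegral_ofReal (hi K) (hnn K)]
        exact ENNReal.ofReal_le_ofReal (hle K)
    _ < ∞ := by simp

end MaximalErgodic

/-! ### Linear growth of monotone functions, from a grid to all times -/

section MonotoneRatio

variable {f : ℝ → ℝ} {h q q' : ℝ}

lemma Monotone.eventually_le_mul_of_nat (hf : Monotone f) (hf0 : f 0 = 0) (hh : 0 < h)
    (hq : q < q') (H : ∀ᶠ n : ℕ in atTop, f (n * h) ≤ q * (n * h)) :
    ∀ᶠ t in atTop, f t ≤ q' * t := by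
  have hq0 : 0 ≤ q := by
    obtain ⟨n, hn, hn0⟩ := (H.and (eventually_gt_atTop 0)).exists
    have hnh : 0 < n * h := by positivity
    have := hf hnh.le
    exact nonneg_of_mul_nonneg_left (by linarith) hnh
  have hfl : Tendsto (fun t : ℝ => ⌊t / h⌋₊ + 1) atTop atTop :=
    (tendsto_add_atTop_nat 1).comp
      (tendsto_nat_floor_atTop.comp (tendsto_id.atTop_div_const hh))
  -- Rounding $t$ up to the grid costs at most $h$; beyond this threshold $q(t+h)\le q't$.
  filter_upwards [hfl.eventually H, eventually_ge_atTop 0, eventually_ge_atTop (q * h / (q' - q))]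
    with t ht ht0 htq
  have h1 : t ≤ (⌊t / h⌋₊ + 1 : ℕ) * h := by
    rw [← div_le_iff₀ hh]; push_cast; exact (Nat.lt_floor_add_one _).le
  have h2 : (⌊t / h⌋₊ + 1 : ℕ) * h ≤ t + h := by
    have := (le_div_iff₀ hh).1 (Nat.floor_le (div_nonneg ht0 hh.le)); push_cast; linarith
  rw [div_le_iff₀ (by linarith)] at htq
  calc f t ≤ _ := hf h1
    _ ≤ _ := ht
    _ ≤ q * (t + h) := by gcongr
    _ ≤ q' * t := by linarith

lemma Monotone.eventually_mul_le_of_nat (hf : Monotone f) (hf0 : f 0 = 0) (hh : 0 < h)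
    (hq : q' < q) (H : ∀ᶠ n : ℕ in atTop, q * (n * h) ≤ f (n * h)) :
    ∀ᶠ t in atTop, q' * t ≤ f t := by
  -- For negative $q$ the bound is trivial since $f\ge f(0)=0$; rounding down below needs $q\ge 0$.
  obtain hq0 | hq0 := lt_or_ge q 0
  · filter_upwards [eventually_ge_atTop 0] with t ht
    have := hf ht
    nlinarith
  have hfl : Tendsto (fun t : ℝ => ⌊t / h⌋₊) atTop atTop :=
    tendsto_nat_floor_atTop.comp (tendsto_id.atTop_div_const hh)
  filter_upwards [hfl.eventually H, eventually_ge_atTop 0, eventually_ge_atTop (q * h / (q - q'))]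
    with t ht ht0 htq
  have h1 : t ≤ ⌊t / h⌋₊ * h + h := by
    have := (div_lt_iff₀ hh).1 (Nat.lt_floor_add_one (t / h)); linarith
  have h2 : ⌊t / h⌋₊ * h ≤ t := (le_div_iff₀ hh).1 (Nat.floor_le (div_nonneg ht0 hh.le))
  rw [div_le_iff₀ (by linarith)] at htq
  calc q' * t ≤ q * (t - h) := by linarith
    _ ≤ q * (⌊t / h⌋₊ * h) := by gcongr; linarith
    _ ≤ _ := ht
    _ ≤ f t := hf h2

end MonotoneRatio

/-! ### The logarithmic mass cocycle under scaling and translation -/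

namespace FractalDistribution

variable {d : ℕ} {μ : Measure (Space d)} {P : Measure (Measure (Space d))}

/-- The normalized Radon measures whose support contains the origin. -/
def chargedMeasures (d : ℕ) : Set (Measure (Space d)) :=
  {μ | μ ∈ normalizedMeasures d ∧ ∀ n : ℕ, 0 < μ (closedBall 0 (Real.exp (-n)))}

/-- `-log μ(B_{e^{-t}}(0))`. -/
noncomputable def negLogMass (t : ℝ) (μ : Measure (Space d)) : ℝ :=
  -Real.log (μ.real (closedBall 0 (Real.exp (-t))))

lemma measurableSet_chargedMeasures : MeasurableSet (chargedMeasures d) := by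
  have h : chargedMeasures d = (radonMeasures d ∩ {μ | μ (closedBall 0 1) = 1}) ∩
      ⋂ n : ℕ, {μ | 0 < μ (closedBall 0 (Real.exp (-n)))} := by
    ext μ; simp [chargedMeasures, normalizedMeasures]
  rw [h]
  refine (measurableSet_radonMeasures.inter ?_).inter (MeasurableSet.iInter fun n => ?_)
  · exact Measure.measurable_coe measurableSet_closedBall (measurableSet_singleton 1)
  · exact measurableSet_lt measurable_const (Measure.measurable_coe measurableSet_closedBall)

lemma measurable_negLogMass (t : ℝ) : Measurable (negLogMass (d := d) t) :=
  ((Measure.measurable_coe measurableSet_closedBall).ennreal_toReal.log).neg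

lemma exists_exp_neg_nat_le {r : ℝ} (hr : 0 < r) : ∃ n : ℕ, Real.exp (-n) ≤ r := by
  obtain ⟨n, hn⟩ := exists_nat_ge (-Real.log r)
  exact ⟨n, by rw [← Real.le_log_iff_exp_le hr]; linarith⟩

lemma measure_closedBall_pos (hμ : μ ∈ chargedMeasures d) {r : ℝ} (hr : 0 < r) :
    0 < μ (closedBall 0 r) := by
  obtain ⟨n, hn⟩ := exists_exp_neg_nat_le hr
  exact (hμ.2 n).trans_le (measure_mono (closedBall_subset_closedBall hn))

lemma measure_closedBall_ne_top (hμ : μ ∈ radonMeasures d) (x : Space d) (r : ℝ) :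
    μ (closedBall x r) ≠ ∞ := by
  have : IsLocallyFiniteMeasure μ := hμ
  exact (isCompact_closedBall x r).measure_lt_top.ne

lemma measureReal_closedBall_pos (hμ : μ ∈ chargedMeasures d) {r : ℝ} (hr : 0 < r) :
    0 < μ.real (closedBall 0 r) :=
  ENNReal.toReal_pos (measure_closedBall_pos hμ hr).ne' (measure_closedBall_ne_top hμ.1.1 _ _)

lemma negLogMass_zero (hμ : μ ∈ chargedMeasures d) : negLogMass 0 μ = 0 := by
  simp [negLogMass, Measure.real, hμ.1.2]

lemma monotone_negLogMass (hμ : μ ∈ chargedMeasures d) : Monotone fun t => negLogMass t μ := by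
  intro s t hst
  refine neg_le_neg (Real.log_le_log (measureReal_closedBall_pos hμ (Real.exp_pos _)) ?_)
  exact ENNReal.toReal_mono (measure_closedBall_ne_top hμ.1.1 _ _)
    (measure_mono (closedBall_subset_closedBall (by gcongr)))

lemma negLogMass_nonneg (hμ : μ ∈ chargedMeasures d) {t : ℝ} (ht : 0 ≤ t) :
    0 ≤ negLogMass t μ :=
  negLogMass_zero hμ ▸ monotone_negLogMass hμ ht

lemma normalize_mem_radonMeasures (hμ : μ ∈ radonMeasures d) (h : μ (closedBall 0 1) ≠ 0) :
    normalize μ ∈ normalizedMeasures d := by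
  have hc := measure_closedBall_ne_top hμ 0 1
  refine ⟨(mem_radonMeasures_iff _).2 fun n => ?_, ?_⟩
  · rw [normalize, Measure.smul_apply, smul_eq_mul]
    exact ENNReal.mul_lt_top (ENNReal.inv_lt_top.2 (pos_iff_ne_zero.2 h))
      ((mem_radonMeasures_iff _).1 hμ n)
  · rw [normalize, Measure.smul_apply, smul_eq_mul, ENNReal.inv_mul_cancel h hc]

lemma map_translate_closedBall (μ : Measure (Space d)) (x : Space d) (r : ℝ) :
    (μ.map fun y => y - x) (closedBall 0 r) = μ (closedBall x r) := by
  rw [Measure.map_apply (by fun_prop) measurableSet_closedBall]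
  congr 1; ext y; simp [dist_eq_norm]

lemma map_scale_closedBall (μ : Measure (Space d)) (t r : ℝ) :
    (μ.map fun y => Real.exp t • y) (closedBall 0 r) =
      μ (closedBall 0 (Real.exp (-t) * r)) := by
  rw [Measure.map_apply (by fun_prop) measurableSet_closedBall]
  congr 1; ext y
  simp only [mem_preimage, mem_closedBall_zero_iff, norm_smul, Real.norm_eq_abs, Real.abs_exp,
    Real.exp_neg]
  rw [← div_eq_inv_mul, le_div_iff₀' (Real.exp_pos t)]

lemma translateStar_closedBall (μ : Measure (Space d)) (x : Space d) (r : ℝ) :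
    translateStar x μ (closedBall 0 r) = (μ (closedBall x 1))⁻¹ * μ (closedBall x r) := by
  rw [translateStar, normalize, Measure.smul_apply, smul_eq_mul, map_translate_closedBall,
    map_translate_closedBall]

lemma scaleStar_closedBall (μ : Measure (Space d)) (t r : ℝ) :
    scaleStar t μ (closedBall 0 r) =
      (μ (closedBall 0 (Real.exp (-t))))⁻¹ * μ (closedBall 0 (Real.exp (-t) * r)) := by
  rw [scaleStar, normalize, Measure.smul_apply, smul_eq_mul, map_scale_closedBall,
    map_scale_closedBall, mul_one]

lemma translateStar_mem_chargedMeasures (hμ : μ ∈ radonMeasures d) {x : Space d}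
    (hx : ∀ r > 0, 0 < μ (closedBall x r)) : translateStar x μ ∈ chargedMeasures d := by
  refine ⟨normalize_mem_radonMeasures ?_ ?_, fun n => ?_⟩
  · rw [mem_radonMeasures_iff]
    intro n
    rw [map_translate_closedBall]
    exact (measure_closedBall_ne_top hμ _ _).lt_top
  · rw [map_translate_closedBall]
    exact (hx 1 one_pos).ne'
  · rw [translateStar_closedBall]
    exact ENNReal.mul_pos (ENNReal.inv_ne_zero.2 (measure_closedBall_ne_top hμ _ _))
      (hx _ (Real.exp_pos _)).ne'

lemma scaleStar_mem_chargedMeasures (hμ : μ ∈ chargedMeasures d) (t : ℝ) :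
    scaleStar t μ ∈ chargedMeasures d := by
  refine ⟨normalize_mem_radonMeasures ?_ ?_, fun n => ?_⟩
  · rw [mem_radonMeasures_iff]
    intro n
    rw [map_scale_closedBall]
    exact (measure_closedBall_ne_top hμ.1.1 _ _).lt_top
  · rw [map_scale_closedBall]
    exact (measure_closedBall_pos hμ (by positivity)).ne'
  · rw [scaleStar_closedBall]
    exact ENNReal.mul_pos (ENNReal.inv_ne_zero.2 (measure_closedBall_ne_top hμ.1.1 _ _))
      (measure_closedBall_pos hμ (by positivity)).ne'

/-- The cocycle identity: the subtracted term is the logarithm of the normalizing constant. -/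
lemma negLogMass_scaleStar (hμ : μ ∈ chargedMeasures d) (s t : ℝ) :
    negLogMass t (scaleStar s μ) = negLogMass (s + t) μ - negLogMass s μ := by
  have h1 := measureReal_closedBall_pos hμ (Real.exp_pos (-s))
  have h2 := measureReal_closedBall_pos hμ (Real.exp_pos (-(s + t)))
  have h : (scaleStar s μ).real (closedBall 0 (Real.exp (-t))) =
      (μ.real (closedBall 0 (Real.exp (-s))))⁻¹ *
        μ.real (closedBall 0 (Real.exp (-(s + t)))) := by
    rw [Measure.real, scaleStar_closedBall, ENNReal.toReal_mul, ENNReal.toReal_inv, ← Real.exp_add,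
      neg_add]
    rfl
  rw [negLogMass, h, Real.log_mul (by positivity) h2.ne', Real.log_inv, negLogMass, negLogMass]
  ring

lemma birkhoffSum_negLogMass (hμ : μ ∈ chargedMeasures d) (h : ℝ) (n : ℕ) :
    birkhoffSum (scaleStar h) (negLogMass h) n μ = negLogMass (n * h) μ := by
  induction n generalizing μ with
  | zero => simp [negLogMass_zero hμ]
  | succ n ih =>
    rw [birkhoffSum_succ', ih (scaleStar_mem_chargedMeasures hμ h), negLogMass_scaleStar hμ]
    push_cast; ring_nf

/-! ### Passing between the origin and typical points -/

/-- A property of the normalized translates of `μ` to `μ`-almost every point, for every `μ`, holds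
almost surely for a quasi-Palm distribution. -/
lemma IsQuasiPalm.ae_mem_of_forall (hq : IsQuasiPalm P) (hP : ∀ᵐ μ ∂P, μ ∈ radonMeasures d)
    {A : Set (Measure (Space d))} (hA : MeasurableSet A)
    (h : ∀ μ ∈ radonMeasures d, ∀ᵐ x ∂μ, translateStar x μ ∈ A) : ∀ᵐ μ ∂P, μ ∈ A := by
  -- This direction uses only that $P$ is absolutely continuous with respect to the diffused
  -- measure, so one neighborhood suffices.
  refine (hq (ball 0 1) isOpen_ball isBounded_ball (by simp)).1 ?_
  change P.bind (diffusion (ball 0 1)) Aᶜ = 0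
  rw [Measure.bind_apply hA.compl (aemeasurable_diffusion hP measurableSet_ball)]
  refine lintegral_eq_zero_of_ae_eq_zero ?_
  filter_upwards [hP] with μ hμ
  rw [diffusion, Measure.map_apply (measurable_translateStar_left hμ) hA.compl]
  exact ae_restrict_of_ae (h μ hμ)

/-- An almost sure property for a quasi-Palm distribution holds almost surely for the normalized
translates of `μ` to `μ`-almost every point. -/
lemma IsQuasiPalm.ae_ae_translateStar (hq : IsQuasiPalm P) (hP : ∀ᵐ μ ∂P, μ ∈ radonMeasures d)
    {p : Measure (Space d) → Prop} (h : ∀ᵐ μ ∂P, p μ) :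
    ∀ᵐ μ ∂P, ∀ᵐ x ∂μ, p (translateStar x μ) := by
  -- The opposite absolute continuity is used here, on balls exhausting the space.
  have key : ∀ᵐ μ ∂P, ∀ n : ℕ, ∀ᵐ x ∂μ.restrict (ball 0 (n + 1)), p (translateStar x μ) := by
    refine ae_all_iff.2 fun n => ?_
    have h1 := (hq (ball 0 (n + 1)) isOpen_ball isBounded_ball
      (mem_ball_self (by positivity))).2.ae_le h
    filter_upwards [Measure.ae_ae_of_ae_bind (aemeasurable_diffusion hP measurableSet_ball) h1, hP]
      with μ hμ hr
    exact ae_of_ae_map (measurable_translateStar_left hr).aemeasurable hμ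
  filter_upwards [key] with μ hμ
  have hU : ⋃ n : ℕ, ball (0 : Space d) (n + 1) = univ := by
    refine eq_univ_of_forall fun x => mem_iUnion.2 ?_
    obtain ⟨n, hn⟩ := exists_nat_gt (dist x 0)
    exact ⟨n, mem_ball.2 (by linarith)⟩
  have h1 := (ae_restrict_iUnion_iff _ _).2 hμ
  rwa [hU, Measure.restrict_univ] at h1

lemma ae_measure_closedBall_pos (μ : Measure (Space d)) :
    ∀ᵐ x ∂μ, ∀ r > 0, 0 < μ (closedBall x r) := by
  filter_upwards [Measure.support_mem_ae (μ := μ)] with x hx r hr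
  exact (Measure.mem_support_iff_forall x).1 hx _ (closedBall_mem_nhds x hr)

lemma ae_translateStar_mem_chargedMeasures (hμ : μ ∈ radonMeasures d) :
    ∀ᵐ x ∂μ, translateStar x μ ∈ chargedMeasures d :=
  (ae_measure_closedBall_pos μ).mono fun _ hx => translateStar_mem_chargedMeasures hμ hx

/-- Almost every point of a Radon measure on `ℝ^d` has positive lower `d`-density. -/
lemma ae_exists_forall_mul_pow_le (hμ : μ ∈ radonMeasures d) :
    ∀ᵐ x ∂μ, ∃ c : ℝ, 0 < c ∧ ∀ᶠ r in 𝓝[>] (0 : ℝ), c * r ^ d ≤ μ.real (closedBall x r) := by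
  have : IsLocallyFiniteMeasure μ := hμ
  -- Lebesgue measure is differentiated with respect to $\mu$: the derivative is finite $\mu$-a.e.
  -- even when $\mu$ is singular, and an upper bound $C$ for $(2r)^d/\mu(B_r(x))$ is a lower bound
  -- for $\mu(B_r(x))$.
  filter_upwards [Besicovitch.ae_tendsto_rnDeriv (volume : Measure (Space d)) μ,
    Measure.rnDeriv_lt_top (volume : Measure (Space d)) μ, ae_measure_closedBall_pos μ]
    with x hx hfin hpos
  obtain ⟨C, hC, hCt⟩ := ENNReal.lt_iff_exists_nnreal_btwn.1 hfin
  have hC0 : 0 < (C : ℝ) := by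
    have : (0 : ℝ≥0∞) < C := bot_le.trans_lt hC
    exact_mod_cast this
  refine ⟨2 ^ d / C, by positivity, ?_⟩
  filter_upwards [hx.eventually_lt_const hC, self_mem_nhdsWithin] with r hr (hr0 : 0 < r)
  have hne := measure_closedBall_ne_top hμ x r
  have h1 := ((ENNReal.div_lt_iff (Or.inl (hpos r hr0).ne') (Or.inl hne)).1 hr).le
  rw [Real.volume_pi_closedBall _ hr0.le, Fintype.card_fin] at h1
  have h2 := ENNReal.toReal_mono (ENNReal.mul_ne_top ENNReal.coe_ne_top hne) h1
  rw [ENNReal.toReal_mul, ENNReal.toReal_ofReal (by positivity), mul_pow] at h2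
  rw [div_mul_eq_mul_div, div_le_iff₀' hC0]
  exact h2

/-! ### Integrability of the cocycle -/

lemma IsFractalDistribution.ae_mem_radonMeasures (hP : IsFractalDistribution P) :
    ∀ᵐ μ ∂P, μ ∈ radonMeasures d :=
  hP.ae_mem.mono fun _ h => h.1

lemma IsFractalDistribution.ae_mem_chargedMeasures (hP : IsFractalDistribution P) :
    ∀ᵐ μ ∂P, μ ∈ chargedMeasures d :=
  hP.quasiPalm.ae_mem_of_forall hP.ae_mem_radonMeasures measurableSet_chargedMeasures
    fun _ hμ => ae_translateStar_mem_chargedMeasures hμ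

lemma IsFractalDistribution.ae_exists_negLogMass_le (hP : IsFractalDistribution P) {h : ℝ}
    (hh : 0 < h) : ∀ᵐ μ ∂P, ∃ n : ℕ, 0 < n ∧ negLogMass (n * h) μ ≤ n * ((d + 1) * h) := by
  refine hP.quasiPalm.ae_mem_of_forall hP.ae_mem_radonMeasures
    (A := {μ | ∃ n : ℕ, 0 < n ∧ negLogMass (n * h) μ ≤ n * ((d + 1) * h)}) ?_ fun μ hμ => ?_
  · have : {μ : Measure (Space d) | ∃ n : ℕ, 0 < n ∧ negLogMass (n * h) μ ≤ n * ((d + 1) * h)} =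
        ⋃ n : ℕ, ⋃ _ : 0 < n, {μ | negLogMass (n * h) μ ≤ n * ((d + 1) * h)} := by ext; simp
    rw [this]
    exact MeasurableSet.iUnion fun n => MeasurableSet.iUnion fun _ =>
      measurableSet_le (measurable_negLogMass _) measurable_const
  filter_upwards [ae_exists_forall_mul_pow_le hμ, ae_measure_closedBall_pos μ] with x ⟨c, hc, hx⟩ hpos
  have hnh : Tendsto (fun n : ℕ => (n : ℝ) * h) atTop atTop :=
    tendsto_natCast_atTop_atTop.atTop_mul_const hh
  have hexp : Tendsto (fun n : ℕ => Real.exp (-(n * h))) atTop (𝓝[>] 0) :=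
    tendsto_nhdsWithin_iff.2 ⟨Real.tendsto_exp_neg_atTop_nhds_zero.comp hnh,
      Eventually.of_forall fun n => Real.exp_pos _⟩
  set m := μ.real (closedBall x 1)
  have hm : 0 < m := ENNReal.toReal_pos (hpos 1 one_pos).ne' (measure_closedBall_ne_top hμ _ _)
  -- The density bound gives at most $d\,nh + \log m - \log c$; the extra $1$ in $d+1$ absorbs the
  -- constant once $nh\ge\log m-\log c$.
  obtain ⟨n, hn, hn0, hnc⟩ := ((hexp.eventually hx).and ((eventually_gt_atTop 0).and
    (hnh.eventually_ge_atTop (Real.log m - Real.log c)))).exists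
  refine ⟨n, hn0, ?_⟩
  have hpow : Real.exp (-(n * h)) ^ d = Real.exp (-(d * (n * h))) := by
    rw [← Real.exp_nat_mul]; ring_nf
  have h1 : (translateStar x μ).real (closedBall 0 (Real.exp (-(n * h)))) =
      m⁻¹ * μ.real (closedBall x (Real.exp (-(n * h)))) := by
    rw [Measure.real, translateStar_closedBall, ENNReal.toReal_mul, ENNReal.toReal_inv]; rfl
  have h2 := Real.log_le_log (by positivity) hn
  have hb : 0 < μ.real (closedBall x (Real.exp (-(n * h)))) := lt_of_lt_of_le (by positivity) hn
  rw [hpow, Real.log_mul hc.ne' (Real.exp_pos _).ne', Real.log_exp] at h2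
  rw [negLogMass, h1, Real.log_mul (by positivity) hb.ne', Real.log_inv]
  linarith

lemma IsFractalDistribution.integrable_negLogMass (hP : IsFractalDistribution P) {h : ℝ}
    (hh : 0 < h) : Integrable (negLogMass h) P := by
  have := hP.isProbabilityMeasure
  refine integrable_of_ae_exists_birkhoffSum_le (c := (d + 1) * h) (hP.invariant h)
    (measurable_negLogMass h) ?_ ?_
  · exact hP.ae_mem_chargedMeasures.mono fun μ hμ => negLogMass_nonneg hμ hh.le
  · filter_upwards [hP.ae_mem_chargedMeasures, hP.ae_exists_negLogMass_le hh] with μ hμ ⟨n, hn, h⟩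
    exact ⟨n, hn, by rwa [birkhoffSum_negLogMass hμ]⟩

/-! ### Zero-one law for growth-rate events -/

lemma IsErgodicFractalDistribution.ae_mem_or_ae_notMem (hP : IsErgodicFractalDistribution P)
    {A : Set (Measure (Space d))} (hA : MeasurableSet A)
    (h : ∀ t, ∀ μ ∈ chargedMeasures d, scaleStar t μ ∈ A ↔ μ ∈ A) :
    (∀ᵐ μ ∂P, μ ∈ A) ∨ ∀ᵐ μ ∂P, μ ∉ A := by
  have := hP.isProbabilityMeasure
  have h0 := hP.ergodic A hA fun t => by
    rw [measure_symmDiff_eq_zero_iff]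
    filter_upwards [hP.toIsFractalDistribution.ae_mem_chargedMeasures] with μ hμ
    exact propext (h t μ hμ)
  rcases h0 with h0 | h0
  · exact Or.inr (measure_eq_zero_iff_ae_notMem.1 h0)
  · exact Or.inl ((prob_compl_eq_zero_iff hA).2 h0)

lemma measurableSet_forall_eventually {p : ℚ → ℕ → Measure (Space d) → Prop} {I : Set ℚ}
    (h : ∀ q n, MeasurableSet {μ | p q n μ}) :
    MeasurableSet {μ | ∀ q ∈ I, ∀ᶠ n in atTop, p q n μ} := by
  have : {μ | ∀ q ∈ I, ∀ᶠ n in atTop, p q n μ} =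
      ⋂ q, ⋂ _ : q ∈ I, ⋃ N, ⋂ n, ⋂ _ : N ≤ n, {μ | p q n μ} := by
    ext μ; simp
  rw [this]
  exact MeasurableSet.iInter fun q => MeasurableSet.iInter fun _ => MeasurableSet.iUnion fun N =>
    MeasurableSet.iInter fun n => MeasurableSet.iInter fun _ => h q n

/-- The left side, with rational slopes and grid times, is measurable; the right side is visibly
invariant under the flow at all real times. The zero-one law needs both. -/
lemma forall_eventually_negLogMass_le_iff (hμ : μ ∈ chargedMeasures d) {h c : ℝ} (hh : 0 < h) :
    (∀ q : ℚ, c < q → ∀ᶠ n : ℕ in atTop, negLogMass (n * h) μ ≤ q * (n * h)) ↔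
      ∀ q : ℝ, c < q → ∀ᶠ t in atTop, negLogMass t μ ≤ q * t := by
  constructor
  · intro H q hq
    obtain ⟨q', hq', hq''⟩ := exists_rat_btwn hq
    exact (monotone_negLogMass hμ).eventually_le_mul_of_nat (negLogMass_zero hμ) hh hq'' (H q' hq')
  · intro H q hq
    exact (tendsto_natCast_atTop_atTop.atTop_mul_const hh).eventually (H q hq)

lemma forall_eventually_le_negLogMass_iff (hμ : μ ∈ chargedMeasures d) {h c : ℝ} (hh : 0 < h) :
    (∀ q : ℚ, q < c → ∀ᶠ n : ℕ in atTop, q * (n * h) ≤ negLogMass (n * h) μ) ↔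
      ∀ q : ℝ, q < c → ∀ᶠ t in atTop, q * t ≤ negLogMass t μ := by
  constructor
  · intro H q hq
    obtain ⟨q', hq', hq''⟩ := exists_rat_btwn hq
    exact (monotone_negLogMass hμ).eventually_mul_le_of_nat (negLogMass_zero hμ) hh hq' (H q' hq'')
  · intro H q hq
    exact (tendsto_natCast_atTop_atTop.atTop_mul_const hh).eventually (H q hq)

/-- A time shift and an additive constant are all that rescaling does to the cocycle, and neither
affects linear growth: any gap between slopes absorbs them. -/
lemma forall_eventually_le_mul_comp_add {f : ℝ → ℝ} {c : ℝ} (s b : ℝ)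
    (H : ∀ q : ℝ, c < q → ∀ᶠ t in atTop, f t ≤ q * t) (q : ℝ) (hq : c < q) :
    ∀ᶠ t in atTop, f (s + t) - b ≤ q * t := by
  obtain ⟨q', hq', hq''⟩ := exists_between hq
  filter_upwards [(tendsto_atTop_add_const_left _ s tendsto_id).eventually (H q' hq'),
    eventually_ge_atTop ((q' * s - b) / (q - q'))] with t ht ht'
  rw [div_le_iff₀ (by linarith)] at ht'
  simp only [id] at ht
  linarith

lemma forall_eventually_negLogMass_le_scaleStar_iff (hμ : μ ∈ chargedMeasures d) (s c : ℝ) :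
    (∀ q : ℝ, c < q → ∀ᶠ t in atTop, negLogMass t (scaleStar s μ) ≤ q * t) ↔
      ∀ q : ℝ, c < q → ∀ᶠ t in atTop, negLogMass t μ ≤ q * t := by
  simp only [negLogMass_scaleStar hμ]
  refine ⟨fun H => ?_, fun H => forall_eventually_le_mul_comp_add _ _ H⟩
  simpa using forall_eventually_le_mul_comp_add (-s) (-negLogMass s μ) H

lemma forall_eventually_mul_le_iff {f : ℝ → ℝ} {c : ℝ} :
    (∀ q : ℝ, q < c → ∀ᶠ t in atTop, q * t ≤ f t) ↔
      ∀ q : ℝ, -c < q → ∀ᶠ t in atTop, -f t ≤ q * t :=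
  ⟨fun H q hq => (H (-q) (by linarith)).mono fun t ht => by linarith,
    fun H q hq => (H (-q) (by linarith)).mono fun t ht => by linarith⟩

lemma forall_eventually_le_negLogMass_scaleStar_iff (hμ : μ ∈ chargedMeasures d) (s c : ℝ) :
    (∀ q : ℝ, q < c → ∀ᶠ t in atTop, q * t ≤ negLogMass t (scaleStar s μ)) ↔
      ∀ q : ℝ, q < c → ∀ᶠ t in atTop, q * t ≤ negLogMass t μ := by
  simp only [negLogMass_scaleStar hμ, forall_eventually_mul_le_iff]
  constructor <;> intro H
  · simpa using forall_eventually_le_mul_comp_add (-s) (negLogMass s μ) H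
  · simpa [neg_add_eq_sub] using
      forall_eventually_le_mul_comp_add (f := fun t => -negLogMass t μ) s (-negLogMass s μ) H

/-! ### The ergodic theorem for the cocycle -/

lemma IsErgodicFractalDistribution.ae_eventually_negLogMass_le
    (hP : IsErgodicFractalDistribution P) {h c : ℝ} (hh : 0 < h)
    (hc : ∫ μ, negLogMass h μ ∂P < c * h) :
    ∀ᵐ μ ∂P, ∀ q : ℝ, c < q → ∀ᶠ t in atTop, negLogMass t μ ≤ q * t := by
  have := hP.isProbabilityMeasure
  have hG := hP.toIsFractalDistribution.ae_mem_chargedMeasures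
  let A : Set (Measure (Space d)) :=
    {μ | ∀ q ∈ {q : ℚ | c < q}, ∀ᶠ n : ℕ in atTop, negLogMass (n * h) μ ≤ q * (n * h)}
  have hA : MeasurableSet A := measurableSet_forall_eventually fun q n =>
    measurableSet_le (measurable_negLogMass _) measurable_const
  have hAG : ∀ μ ∈ chargedMeasures d, μ ∈ A ↔
      ∀ q : ℝ, c < q → ∀ᶠ t in atTop, negLogMass t μ ≤ q * t := fun μ hμ =>
    forall_eventually_negLogMass_le_iff hμ hh
  rcases hP.ae_mem_or_ae_notMem hA fun t μ hμ => by
    rw [hAG _ (scaleStar_mem_chargedMeasures hμ t), hAG _ hμ,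
      forall_eventually_negLogMass_le_scaleStar_iff hμ] with H | H
  · filter_upwards [H, hG] with μ hμ hμG using (hAG μ hμG).1 hμ
  -- If the event fails almost surely, almost every orbit has a Birkhoff average of at least $ch$,
  -- so the maximal theorem contradicts `hc`.
  · refine absurd (le_integral_of_ae_exists_le_birkhoffSum (c := c * h) (hP.invariant h)
      (measurable_negLogMass h) (hP.toIsFractalDistribution.integrable_negLogMass hh) ?_) hc.not_ge
    filter_upwards [H, hG] with μ hμ hμG
    simp only [A, mem_ofPred_eq, not_forall, not_eventually, not_le] at hμ
    obtain ⟨q, hq, hf⟩ := hμ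
    obtain ⟨n, hn, hn0⟩ := (hf.and_eventually (eventually_gt_atTop 0)).exists
    refine ⟨n, hn0, ?_⟩
    rw [birkhoffSum_negLogMass hμG]
    have : c * (n * h) ≤ q * (n * h) := by gcongr
    linarith

lemma IsErgodicFractalDistribution.ae_eventually_le_negLogMass
    (hP : IsErgodicFractalDistribution P) {h c : ℝ} (hh : 0 < h)
    (hc : c * h < ∫ μ, negLogMass h μ ∂P) :
    ∀ᵐ μ ∂P, ∀ q : ℝ, q < c → ∀ᶠ t in atTop, q * t ≤ negLogMass t μ := by
  have := hP.isProbabilityMeasure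
  have hG := hP.toIsFractalDistribution.ae_mem_chargedMeasures
  let A : Set (Measure (Space d)) :=
    {μ | ∀ q ∈ {q : ℚ | q < c}, ∀ᶠ n : ℕ in atTop, q * (n * h) ≤ negLogMass (n * h) μ}
  have hA : MeasurableSet A := measurableSet_forall_eventually fun q n =>
    measurableSet_le measurable_const (measurable_negLogMass _)
  have hAG : ∀ μ ∈ chargedMeasures d, μ ∈ A ↔
      ∀ q : ℝ, q < c → ∀ᶠ t in atTop, q * t ≤ negLogMass t μ := fun μ hμ =>
    forall_eventually_le_negLogMass_iff hμ hh
  rcases hP.ae_mem_or_ae_notMem hA fun t μ hμ => by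
    rw [hAG _ (scaleStar_mem_chargedMeasures hμ t), hAG _ hμ,
      forall_eventually_le_negLogMass_scaleStar_iff hμ] with H | H
  · filter_upwards [H, hG] with μ hμ hμG using (hAG μ hμG).1 hμ
  · refine absurd (integral_le_of_ae_exists_birkhoffSum_le (c := c * h) (hP.invariant h)
      (measurable_negLogMass h) (hP.toIsFractalDistribution.integrable_negLogMass hh) ?_) hc.not_ge
    filter_upwards [H, hG] with μ hμ hμG
    simp only [A, mem_ofPred_eq, not_forall, not_eventually, not_le] at hμ
    obtain ⟨q, hq, hf⟩ := hμ
    obtain ⟨n, hn, hn0⟩ := (hf.and_eventually (eventually_gt_atTop 0)).exists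
    refine ⟨n, hn0, ?_⟩
    rw [birkhoffSum_negLogMass hμG]
    have : q * (n * h) ≤ c * (n * h) := by gcongr
    linarith

/-- The pointwise ergodic theorem for the cocycle `negLogMass` of the scaling flow. -/
theorem IsErgodicFractalDistribution.ae_tendsto_negLogMass_div
    (hP : IsErgodicFractalDistribution P) {h : ℝ} (hh : 0 < h) :
    ∀ᵐ μ ∂P, Tendsto (fun t => negLogMass t μ / t) atTop
      (𝓝 ((∫ μ, negLogMass h μ ∂P) / h)) := by
  set I := (∫ μ, negLogMass h μ ∂P) / h
  have hI : ∫ μ, negLogMass h μ ∂P = I * h := (div_mul_cancel₀ _ hh.ne').symm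
  -- Rational $c$ gives a single null set for all bounds.
  have h1 : ∀ᵐ μ ∂P, ∀ c : ℚ, I < c → ∀ q : ℝ, c < q → ∀ᶠ t in atTop, negLogMass t μ ≤ q * t :=
    ae_all_iff.2 fun c => by
      by_cases hc : I < c
      · filter_upwards [hP.ae_eventually_negLogMass_le hh (c := c) (by rw [hI]; gcongr)]
          with μ hμ _ using hμ
      · exact Eventually.of_forall fun μ hc' => absurd hc' hc
  have h2 : ∀ᵐ μ ∂P, ∀ c : ℚ, c < I → ∀ q : ℝ, q < c → ∀ᶠ t in atTop, q * t ≤ negLogMass t μ :=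
    ae_all_iff.2 fun c => by
      by_cases hc : c < I
      · filter_upwards [hP.ae_eventually_le_negLogMass hh (c := c) (by rw [hI]; gcongr)]
          with μ hμ _ using hμ
      · exact Eventually.of_forall fun μ hc' => absurd hc' hc
  filter_upwards [h1, h2] with μ hμ1 hμ2
  refine tendsto_order.2 ⟨fun a ha => ?_, fun a ha => ?_⟩
  · obtain ⟨c, hac, hcI⟩ := exists_rat_btwn ha
    obtain ⟨q, haq, hqc⟩ := exists_between hac
    filter_upwards [hμ2 c hcI q hqc, eventually_gt_atTop 0] with t ht ht0
    exact haq.trans_le ((le_div_iff₀ ht0).2 ht)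
  · obtain ⟨c, hIc, hca⟩ := exists_rat_btwn ha
    obtain ⟨q, hcq, hqa⟩ := exists_between hca
    filter_upwards [hμ1 c hIc q hcq, eventually_gt_atTop 0] with t ht ht0
    exact ((div_le_iff₀ ht0).2 ht).trans_lt hqa

/-! ### Local dimensions and the main theorem -/

lemma logQuotient_eq_coe (hμ : μ ∈ radonMeasures d) {x : Space d} {r : ℝ}
    (hx : 0 < μ (closedBall x r)) :
    logQuotient μ x r = ((Real.log (μ.real (closedBall x r)) / Real.log r : ℝ) : EReal) := by
  rw [logQuotient, ENNReal.log_pos_real hx.ne' (measure_closedBall_ne_top hμ _ _), EReal.coe_div]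
  rfl

/-- The local dimension of `μ` at `x` is the growth rate of `negLogMass` at the normalized translate
of `μ` to `x`. -/
lemma tendsto_logQuotient_of_translateStar (hμ : μ ∈ radonMeasures d) {x : Space d}
    (hx : ∀ r > 0, 0 < μ (closedBall x r)) {α : ℝ}
    (h : Tendsto (fun t => negLogMass t (translateStar x μ) / t) atTop (𝓝 α)) :
    Tendsto (logQuotient μ x) (𝓝[>] 0) (𝓝 (α : EReal)) := by
  have hpos : ∀ r > 0, 0 < μ.real (closedBall x r) := fun r hr =>
    ENNReal.toReal_pos (hx r hr).ne' (measure_closedBall_ne_top hμ _ _)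
  have hlog : Tendsto (fun r => -Real.log r) (𝓝[>] 0) atTop :=
    tendsto_neg_atBot_atTop.comp Real.tendsto_log_nhdsGT_zero
  -- With $t=-\log r$, the normalization of the translate contributes $\log\mu(B_1(x))/t$, which
  -- tends to $0$.
  have h1 := (h.comp hlog).sub
    ((tendsto_const_nhds (x := Real.log (μ.real (closedBall x 1)))).div_atTop hlog)
  rw [sub_zero] at h1
  refine ((continuous_coe_real_ereal.tendsto α).comp h1).congr' ?_
  filter_upwards [self_mem_nhdsWithin] with r (hr : 0 < r)
  rw [logQuotient_eq_coe hμ (hx r hr)]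
  have h2 : (translateStar x μ).real (closedBall 0 r) =
      (μ.real (closedBall x 1))⁻¹ * μ.real (closedBall x r) := by
    rw [Measure.real, translateStar_closedBall, ENNReal.toReal_mul, ENNReal.toReal_inv]; rfl
  simp only [Function.comp_apply, negLogMass, neg_neg, Real.exp_log hr, h2]
  rw [Real.log_mul (inv_pos.2 (hpos 1 one_pos)).ne' (hpos r hr).ne', Real.log_inv]
  congr 1
  rw [← sub_div, div_neg, ← neg_div]
  congr 1
  ring

theorem IsErgodicFractalDistribution.ae_hasExactDim (hP : IsErgodicFractalDistribution P) {α : ℝ}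
    (h : ∀ᵐ μ ∂P, Tendsto (fun t => negLogMass t μ / t) atTop (𝓝 α)) :
    ∀ᵐ μ ∂P, HasExactDim μ (α : EReal) := by
  have hr := hP.toIsFractalDistribution.ae_mem_radonMeasures
  filter_upwards [hP.quasiPalm.ae_ae_translateStar hr h, hr] with μ hμ hμr
  filter_upwards [hμ, ae_measure_closedBall_pos μ] with x hx hpos
  have := tendsto_logQuotient_of_translateStar hμr hpos hx
  exact ⟨this.liminf_eq, this.limsup_eq⟩

end FractalDistribution

theorem mainTheorem6 (d : ℕ) (P : Measure (Measure (FractalDistribution.Space d)))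
    (hP : FractalDistribution.IsErgodicFractalDistribution P) :
    ∃ α : ℝ,
      (∀ᵐ μ ∂P, FractalDistribution.HasExactDim μ (α : EReal)) ∧
      ∀ r : ℝ, 0 < r → r < 1 →
        Integrable (fun μ : Measure (FractalDistribution.Space d) =>
          Real.log (μ.real (closedBall 0 r)) / Real.log r) P ∧
        α = ∫ μ : Measure (FractalDistribution.Space d),
          Real.log (μ.real (closedBall 0 r)) / Real.log r ∂P := by
  have := hP.isProbabilityMeasure
  have h1 := hP.ae_tendsto_negLogMass_div one_pos
  refine ⟨_, hP.ae_hasExactDim h1, fun r hr0 hr1 => ?_⟩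
  have hh : 0 < -Real.log r := neg_pos.2 (Real.log_neg hr0 hr1)
  have hf : (fun μ : Measure (FractalDistribution.Space d) =>
      Real.log (μ.real (closedBall 0 r)) / Real.log r) =
      fun μ => FractalDistribution.negLogMass (-Real.log r) μ / -Real.log r := by
    funext μ
    rw [FractalDistribution.negLogMass, neg_neg, Real.exp_log hr0, neg_div_neg_eq]
  rw [hf]
  refine ⟨(hP.toIsFractalDistribution.integrable_negLogMass hh).div_const _, ?_⟩
  rw [integral_div]
  -- The normalized integrals for steps $1$ and $-\log r$ are limits of the same function of $t$ at
  -- a common typical $\mu$, so they agree.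
  obtain ⟨μ, hμ1, hμ2⟩ := (h1.and (hP.ae_tendsto_negLogMass_div hh)).exists
  exact tendsto_nhds_unique hμ1 hμ2
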